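/- All graphs are finite and simple. A cograph is a graph that contains no induced path on four vertices. For a graph $G$ of order $n\ge 1$ let $a_k(G)$ be the number of $k$-element vertex sets that induce a connected subgraph of $G$, let $\Phi_G(x)=\sum_{k=1}^{n}a_k(G)x^k$, and let $M_G=\Phi_G'(1)/\Phi_G(1)$ be the mean order of the connected induced subgraphs of $G$. Write $\cup$ for disjoint union of graphs. Theorem. (i) For each $m\ge 1$ there is, up to isomorphism, exactly one connected cograph $Q_m$ of order $m$ whose mean is maximum among all connected cographs of order $m$. (ii) If $n\ge 2$, then $K_1\cup Q_{n-1}$ is a disconnected cograph of order $n$, and every disconnected cograph $G$ of order $n$ satisfies $M_G\le M_{K_1\cup Q_{n-1}}$. (iii) In particular, for every $n\ge 8$, $K_1\cup K_{1,n-2}$ is a disconnected cograph of order $n$, and every disconnected cograph $G$ of order $n$ satisfies $M_G\le M_{K_1\cup K_{1,n-2}}$. -/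

import Mathlib

universe u v

open Polynomial

noncomputable section

/-- A cograph is a graph that has no induced path on four vertices. -/
def IsCograph {V : Type*} (G : SimpleGraph V) : Prop :=
  ¬ (SimpleGraph.pathGraph 4).IsIndContained G

/-- `a_k(G)`: the number of `k`-element vertex sets that induce a connected subgraph of `G`. -/
def connInducedCount {V : Type*} (G : SimpleGraph V) (k : ℕ) : ℕ :=
  {S : Finset V | S.card = k ∧ (G.induce (S : Set V)).Connected}.ncard

/-- The connected induced subgraph polynomial `Φ_G(x) = ∑_{k=1}^{n} a_k(G) x^k`. -/
def connInducedPoly {V : Type*} [Fintype V] (G : SimpleGraph V) : ℚ[X] :=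
  ∑ k ∈ Finset.Icc 1 (Fintype.card V), C (connInducedCount G k : ℚ) * X ^ k

/-- The global mean `M_G = Φ_G'(1) / Φ_G(1)`, the mean order of the connected induced subgraphs
of `G`. -/
def globalMean {V : Type*} [Fintype V] (G : SimpleGraph V) : ℚ :=
  (derivative (connInducedPoly G)).eval 1 / (connInducedPoly G).eval 1

/-- `Q` is a connected cograph whose global mean is maximum among all connected cographs of the
same order. (Every graph of that order is isomorphic to one on the vertex set of `Q`.) -/
def IsMaxMeanConnectedCograph {W : Type*} [Fintype W] (Q : SimpleGraph W) : Prop :=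
  IsCograph Q ∧ Q.Connected ∧
    ∀ H : SimpleGraph W, IsCograph H → H.Connected → globalMean H ≤ globalMean Q

/-- The one-vertex graph `K_1`. -/
abbrev graphK1 : SimpleGraph (Fin 1) := ⊤

end

/-! Fix a number μ and sum μ - |T| over all connected vertex sets T. This shortfall equals Φ_G(1)(μ
- M_G), so M_G ≤ μ exactly when it is nonnegative. With μ the mean of the conjectured extremal
graph, whose shortfall is then 0, it remains to show that no competitor has a smaller shortfall at
the same μ.

By Seinsche's theorem (`PathFourFree.splits`) every cograph of order at least two is a disjoint
union or a join of smaller ones. The shortfall is additive over unions. In a join every set meeting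
both sides is connected, so these sets contribute a quantity `crossShortfall` depending only on the
two orders. Singletons contribute the same amount in every graph of given order and are set aside,
leaving `properShortfall`.

Induction gives `properShortfall` ≥ 0 once μ ≥ |S|/2 + 1, and strictly above that bound it vanishes
only on edgeless sets. Deleting the edges inside the sides of a join therefore does not raise the
shortfall: among connected cographs of order m ≥ 4 the minimum is attained by a complete bipartite
graph (`PathFourFree.bipartiteBound`). Numerical comparison selects K_{2,m-2} for m = 4, 5, 6 and
the star for m ≥ 7; for m ≤ 3 the complete graph wins.

For disconnected graphs of order m + 1, a part of order at most m - 1 has nonnegative shortfall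
because μ ≥ m/2 (`PathFourFree.shortfall_nonneg`). The only other case is an isolated vertex beside
a connected cograph of order m, which the connected comparison settles. -/

/-- Every path `a b c d` on four vertices of `G` has a chord. -/
def PathFourFree {V : Type*} (G : SimpleGraph V) : Prop :=
  ∀ a b c d, G.Adj a b → G.Adj b c → G.Adj c d → G.Adj a c ∨ G.Adj b d ∨ G.Adj a d

theorem PathFourFree.isCograph {V : Type*} {G : SimpleGraph V} (hG : PathFourFree G) :
    IsCograph G := by
  rintro ⟨f⟩
  have key : ∀ i j, G.Adj (f i) (f j) ↔ (SimpleGraph.pathGraph 4).Adj i j := fun i j =>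
    f.map_adj_iff
  have h := hG (f 0) (f 1) (f 2) (f 3)
  simp only [key, SimpleGraph.pathGraph_adj] at h
  simp at h

theorem IsCograph.pathFourFree {V : Type*} {G : SimpleGraph V} (hG : IsCograph G) :
    PathFourFree G := by
  intro a b c d hab hbc hcd
  by_contra! hn
  obtain ⟨hac, hbd, had⟩ := hn
  have nac : a ≠ c := by rintro rfl; exact had hcd
  have nbd : b ≠ d := by rintro rfl; exact had hab
  have nad : a ≠ d := by rintro rfl; exact hac hcd.symm
  refine hG ⟨⟨⟨![a, b, c, d], ?_⟩, ?_⟩⟩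
  · intro i j hij
    fin_cases i <;> fin_cases j <;>
      simp_all [hab.ne, hbc.ne, hcd.ne, hab.ne', hbc.ne', hcd.ne', nac.symm, nbd.symm, nad.symm]
  · intro i j
    change G.Adj (![a, b, c, d] i) (![a, b, c, d] j) ↔ _
    fin_cases i <;> fin_cases j <;>
      simp [SimpleGraph.pathGraph_adj, hab, hbc, hcd, hac, hbd, had, hab.symm, hbc.symm,
        hcd.symm, G.adj_comm c a, G.adj_comm d b, G.adj_comm d a]

/-- The path on four vertices is self-complementary: if a b c d is induced in the complement, then b
d a c is induced in G. -/
theorem PathFourFree.compl {V : Type*} {G : SimpleGraph V} (hG : PathFourFree G) :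
    PathFourFree Gᶜ := by
  intro a b c d hab hbc hcd
  by_contra! hn
  simp only [SimpleGraph.compl_adj] at *
  obtain ⟨hac, hbd, had⟩ := hn
  have nac : a ≠ c := by
    rintro rfl; exact had hcd
  have nbd : b ≠ d := by rintro rfl; exact had hab
  have nad : a ≠ d := by rintro rfl; exact hac ⟨nac, fun h => hcd.2 h.symm⟩
  rcases hG b d a c (by tauto) ((by tauto : G.Adj a d).symm) (by tauto) with h | h | h
  · exact hab.2 h.symm
  · exact hcd.2 h.symm
  · exact hbc.2 h

/-! ### Seinsche's theorem -/

section Split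

variable {V : Type*} {G : SimpleGraph V}

/-- All pairs from `A × B` are non-adjacent. -/
def NoEdgesBetween (G : SimpleGraph V) (A B : Finset V) : Prop :=
  ∀ a ∈ A, ∀ b ∈ B, ¬ G.Adj a b

/-- All pairs from `A × B` are adjacent. -/
def AllEdgesBetween (G : SimpleGraph V) (A B : Finset V) : Prop :=
  ∀ a ∈ A, ∀ b ∈ B, G.Adj a b

theorem NoEdgesBetween.symm {A B : Finset V} (h : NoEdgesBetween G A B) :
    NoEdgesBetween G B A := fun a ha b hb hab => h b hb a ha hab.symm

theorem AllEdgesBetween.symm {A B : Finset V} (h : AllEdgesBetween G A B) :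
    AllEdgesBetween G B A := fun a ha b hb => (h b hb a ha).symm

variable [DecidableEq V]

/-- `S` is a union of two nonempty disjoint sets with no edges, or with all edges, between
them. -/
def Splits (G : SimpleGraph V) (S : Finset V) : Prop :=
  ∃ A B : Finset V, A.Nonempty ∧ B.Nonempty ∧ Disjoint A B ∧ A ∪ B = S ∧
    (NoEdgesBetween G A B ∨ AllEdgesBetween G A B)

theorem Splits.of_compl {S : Finset V} (h : Splits Gᶜ S) : Splits G S := by
  obtain ⟨A, B, hA, hB, hd, hu, h | h⟩ := h
  · refine ⟨A, B, hA, hB, hd, hu, Or.inr fun a ha b hb => ?_⟩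
    have := h a ha b hb
    simp only [SimpleGraph.compl_adj, not_and, not_not] at this
    exact this (fun e => Finset.disjoint_left.1 hd ha (e ▸ hb))
  · exact ⟨A, B, hA, hB, hd, hu, Or.inl fun a ha b hb => (h a ha b hb).2⟩

theorem splits_of_filter {S A : Finset V} (hA : A.Nonempty) (hAS : A ⊆ S)
    (hS : (S \ A).Nonempty)
    (h : NoEdgesBetween G A (S \ A) ∨ AllEdgesBetween G A (S \ A)) : Splits G S :=
  ⟨A, S \ A, hA, hS, Finset.disjoint_sdiff, Finset.union_sdiff_of_subset hAS, h⟩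

theorem PathFourFree.splits_insert_of_not_adj (hG : PathFourFree G) {A B : Finset V} {v u : V}
    (hB : B.Nonempty) (hv : v ∉ A ∪ B)
    (h : NoEdgesBetween G A B) (hu : u ∈ A) (huv : ¬ G.Adj v u) :
    Splits G (insert v (A ∪ B)) := by
  classical
  simp only [Finset.mem_union, not_or] at hv
  by_cases hz : ∃ z ∈ B, G.Adj v z
  · obtain ⟨z, hz, hvz⟩ := hz
    -- The non-neighbours of v in A are cut off from the rest: an edge from such an x to a neighbour
    -- y of v in A would make x y v z a chordless path.
    refine splits_of_filter (A := A.filter fun x => ¬ G.Adj v x) ⟨u, by simp [hu, huv]⟩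
      (fun x hx => by simp at hx ⊢; tauto) ⟨v, by simp [hv.1]⟩ (Or.inl ?_)
    intro x hx y hy hxy
    simp only [Finset.mem_filter, Finset.mem_sdiff, Finset.mem_insert, Finset.mem_union,
      not_and, not_not] at hx hy
    obtain ⟨rfl | hyA | hyB, hy⟩ := hy
    · exact hx.2 hxy.symm
    · rcases hG x y v z hxy (hy hyA).symm hvz with h' | h' | h'
      · exact hx.2 h'.symm
      · exact h y hyA z hz h'
      · exact h x hx.1 z hz h'
    · exact h x hx.1 y hyB hxy
  · push Not at hz
    refine splits_of_filter (A := B) hB (fun x hx => by simp [hx]) ⟨v, by simp [hv.2]⟩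
      (Or.inl ?_)
    intro x hx y hy hxy
    simp only [Finset.mem_sdiff, Finset.mem_insert, Finset.mem_union] at hy
    obtain ⟨rfl | hyA | hyB, hy⟩ := hy
    · exact hz x hx hxy.symm
    · exact h y hyA x hx hxy.symm
    · exact hy hyB

theorem PathFourFree.splits_insert (hG : PathFourFree G) {A B : Finset V} {v : V}
    (hA : A.Nonempty) (hB : B.Nonempty) (hv : v ∉ A ∪ B)
    (h : NoEdgesBetween G A B) : Splits G (insert v (A ∪ B)) := by
  by_cases hall : ∀ u ∈ A ∪ B, G.Adj v u
  · refine ⟨{v}, A ∪ B, by simp, hA.mono Finset.subset_union_left, by simpa using hv, by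
      ext; simp, Or.inr ?_⟩
    intro a ha b hb
    rw [Finset.mem_singleton.1 ha]
    exact hall b hb
  · push Not at hall
    obtain ⟨u, hu, huv⟩ := hall
    rcases Finset.mem_union.1 hu with hu | hu
    · exact hG.splits_insert_of_not_adj hB hv h hu huv
    · rw [Finset.union_comm] at hv ⊢
      exact hG.splits_insert_of_not_adj hA hv h.symm hu huv

/-- **Seinsche's theorem**: a set of at least two vertices of a graph without induced paths on
four vertices induces a disconnected graph or a graph with disconnected complement. -/
theorem PathFourFree.splits (hG : PathFourFree G) :
    ∀ S : Finset V, 2 ≤ S.card → Splits G S := by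
  intro S
  induction S using Finset.induction_on with
  | empty => simp
  | insert v S hv ih =>
    intro hS
    rw [Finset.card_insert_of_notMem hv] at hS
    rcases Nat.lt_or_ge S.card 2 with h1 | h2
    · obtain ⟨u, rfl⟩ := Finset.card_eq_one.1 (by omega : S.card = 1)
      refine ⟨{v}, {u}, by simp, by simp, by simpa using hv, by ext; simp, ?_⟩
      by_cases h : G.Adj v u
      · exact Or.inr (by simpa [AllEdgesBetween] using h)
      · exact Or.inl (by simpa [NoEdgesBetween] using h)
    · obtain ⟨A, B, hA, hB, hd, rfl, h | h⟩ := ih h2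
      · exact hG.splits_insert hA hB hv h
      -- A join in G is a disjoint union in the complement, so the previous case applies there.
      · exact Splits.of_compl (hG.compl.splits_insert hA hB hv
          fun a ha b hb hab => ((SimpleGraph.compl_adj ..).1 hab).2 (h a ha b hb))

end Split

/-! ### Connected vertex sets in unions and joins -/

section Conn

variable {V : Type*} {G : SimpleGraph V}

/-- The finite set `S` induces a connected subgraph of `G`. -/
def Conn (G : SimpleGraph V) (S : Finset V) : Prop := (G.induce (S : Set V)).Connected

theorem Conn.nonempty {S : Finset V} (h : Conn G S) : S.Nonempty := by
  obtain ⟨x, hx⟩ := SimpleGraph.Connected.nonempty h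
  exact ⟨x, hx⟩

theorem conn_singleton (x : V) : Conn G {x} := by
  unfold Conn
  rw [Finset.coe_singleton]
  have : Unique ({x} : Set V) := Set.uniqueSingleton x
  exact ⟨SimpleGraph.Preconnected.of_subsingleton⟩

theorem conn_univ [Fintype V] : Conn G Finset.univ ↔ G.Connected := by
  unfold Conn
  rw [Finset.coe_univ]
  exact (SimpleGraph.induceUnivIso G).connected_iff

theorem conn_map {U : Type*} {H : SimpleGraph U} (f : H ↪g G) (S : Finset U) :
    Conn G (S.map f.toEmbedding) ↔ Conn H S := by
  unfold Conn
  rw [Finset.coe_map]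
  refine (SimpleGraph.Iso.connected_iff (RelIso.mk (Equiv.Set.image f S f.injective) ?_)).symm
  intro a b
  exact f.map_adj_iff

variable [DecidableEq V]

theorem AllEdgesBetween.conn {A B T : Finset V} (h : AllEdgesBetween G A B) (hT : T ⊆ A ∪ B)
    (hA : ¬ T ⊆ A) (hB : ¬ T ⊆ B) : Conn G T := by
  obtain ⟨b, hbT, hbA⟩ := Finset.not_subset.1 hA
  obtain ⟨a, haT, haB⟩ := Finset.not_subset.1 hB
  have hb : b ∈ B := (Finset.mem_union.1 (hT hbT)).resolve_left hbA
  have ha : a ∈ A := (Finset.mem_union.1 (hT haT)).resolve_right haB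
  have hab : (G.induce (T : Set V)).Adj ⟨a, haT⟩ ⟨b, hbT⟩ := h a ha b hb
  unfold Conn
  rw [SimpleGraph.connected_iff_exists_forall_reachable]
  refine ⟨⟨a, haT⟩, ?_⟩
  rintro ⟨x, hx⟩
  rcases Finset.mem_union.1 (hT hx) with hxA | hxB
  · exact hab.reachable.trans
      (show (G.induce (T : Set V)).Adj ⟨b, hbT⟩ ⟨x, hx⟩ from (h x hxA b hb).symm).reachable
  · exact (show (G.induce (T : Set V)).Adj ⟨a, haT⟩ ⟨x, hx⟩ from h a ha x hxB).reachable

theorem NoEdgesBetween.subset_of_conn {A B T : Finset V} (h : NoEdgesBetween G A B)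
    (hT : T ⊆ A ∪ B) (hc : Conn G T) : T ⊆ A ∨ T ⊆ B := by
  by_contra! hn
  obtain ⟨b, hbT, hbA⟩ := Finset.not_subset.1 hn.1
  obtain ⟨a, haT, haB⟩ := Finset.not_subset.1 hn.2
  have ha : a ∈ A := (Finset.mem_union.1 (hT haT)).resolve_right haB
  have key : ∀ x y : (T : Set V), (G.induce (T : Set V)).Reachable x y →
      (x : V) ∈ A → (y : V) ∈ A := by
    rintro x y ⟨p⟩
    induction p with
    | nil => exact id
    | @cons u v w huv _ ih =>
      intro hu
      refine ih ?_
      by_contra hv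
      exact h u hu v ((Finset.mem_union.1 (hT v.2)).resolve_left hv) huv
  exact hbA (key ⟨a, haT⟩ ⟨b, hbT⟩ (hc.preconnected _ _) ha)

theorem NoEdgesBetween.not_conn {A B : Finset V} (h : NoEdgesBetween G A B)
    (hd : Disjoint A B) (hA : A.Nonempty) (hB : B.Nonempty) : ¬ Conn G (A ∪ B) := by
  intro hc
  rcases h.subset_of_conn subset_rfl hc with h' | h'
  · obtain ⟨b, hb⟩ := hB
    exact Finset.disjoint_left.1 hd (h' (Finset.mem_union_right _ hb)) hb
  · obtain ⟨a, ha⟩ := hA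
    exact Finset.disjoint_left.1 hd ha (h' (Finset.mem_union_left _ ha))

theorem AllEdgesBetween.conn_union {A B : Finset V} (h : AllEdgesBetween G A B)
    (hd : Disjoint A B) (hA : A.Nonempty) (hB : B.Nonempty) : Conn G (A ∪ B) := by
  refine h.conn subset_rfl (fun h' => ?_) (fun h' => ?_)
  · obtain ⟨b, hb⟩ := hB
    exact Finset.disjoint_left.1 hd (h' (Finset.mem_union_right _ hb)) hb
  · obtain ⟨a, ha⟩ := hA
    exact Finset.disjoint_left.1 hd ha (h' (Finset.mem_union_left _ ha))

theorem conn_pair {x y : V} (hxy : x ≠ y) : Conn G {x, y} ↔ G.Adj x y := by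
  have hu : ({x} ∪ {y} : Finset V) = {x, y} := by ext; simp
  have hd : Disjoint ({x} : Finset V) {y} := by simpa using hxy
  constructor
  · intro h
    by_contra hn
    have : NoEdgesBetween G {x} {y} := by simpa [NoEdgesBetween] using hn
    exact this.not_conn hd (by simp) (by simp) (hu ▸ h)
  · intro h
    have : AllEdgesBetween G {x} {y} := by simpa [AllEdgesBetween] using h
    exact hu ▸ this.conn_union hd (by simp) (by simp)

end Conn

/-! ### The shortfall and its behaviour under union and join -/

section Shortfall

open scoped Classical in
/-- The sum of `μ - |T|` over all connected subsets `T` of `S`. -/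
noncomputable def shortfall {V : Type*} (G : SimpleGraph V) (μ : ℚ) (S : Finset V) : ℚ :=
  ∑ T ∈ S.powerset with Conn G T, (μ - T.card)

open scoped Classical in
/-- The sum of `μ - |T|` over all connected subsets `T` of `S` with at least two vertices. -/
noncomputable def properShortfall {V : Type*} (G : SimpleGraph V) (μ : ℚ) (S : Finset V) : ℚ :=
  ∑ T ∈ S.powerset with Conn G T ∧ 2 ≤ T.card, (μ - T.card)

/-- The sum of `μ - |T|` over all subsets `T` of `A ∪ B` meeting both `A` and `B`, where `A` and
`B` are disjoint sets of orders `a` and `b`. -/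
def crossShortfall (μ : ℚ) (a b : ℕ) : ℚ :=
  -- There are (2^a - 1)(2^b - 1) crossing sets. Over the nonempty subsets of A the orders sum to a
  -- 2^(a-1) = a(2^a - 1)/2 + a/2, and likewise for B; the excess a/2 and b/2 give the correction
  -- term.
  (2 ^ a - 1) * (2 ^ b - 1) * (μ - (a + b) / 2) - (a * (2 ^ b - 1) + b * (2 ^ a - 1)) / 2

theorem crossShortfall_comm (μ : ℚ) (a b : ℕ) : crossShortfall μ a b = crossShortfall μ b a := by
  unfold crossShortfall; ring

variable {V : Type*} {G : SimpleGraph V} {μ : ℚ}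

theorem sum_powerset_sub_card (μ : ℚ) (S : Finset V) :
    ∑ T ∈ S.powerset, (μ - T.card) = 2 ^ S.card * (μ - S.card / 2) := by
  classical
  induction S using Finset.induction_on with
  | empty => simp
  | insert v S hv ih =>
    rw [Finset.sum_powerset_insert hv, Finset.card_insert_of_notMem hv]
    have : ∑ T ∈ S.powerset, (μ - ((insert v T).card : ℚ)) =
        ∑ T ∈ S.powerset, ((μ - T.card) - 1) := by
      refine Finset.sum_congr rfl fun T hT => ?_
      rw [Finset.card_insert_of_notMem fun h => hv (Finset.mem_powerset.1 hT h)]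
      push_cast; ring
    rw [this, Finset.sum_sub_distrib (f := fun T : Finset V => μ - (T.card : ℚ)), ih]
    simp only [Finset.sum_const, Finset.card_powerset, nsmul_eq_mul]
    push_cast; ring

theorem sum_powerset_union [DecidableEq V] {A B : Finset V} (hd : Disjoint A B)
    (F : Finset V → ℚ) (hF : ∀ T ⊆ A ∪ B, ¬ T ⊆ A → ¬ T ⊆ B → F T = 0) :
    ∑ T ∈ (A ∪ B).powerset, F T =
      ∑ T ∈ A.powerset, F T + ∑ T ∈ B.powerset, F T - F ∅ := by
  have h1 : ∑ T ∈ A.powerset ∪ B.powerset, F T = ∑ T ∈ (A ∪ B).powerset, F T := by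
    refine Finset.sum_subset (fun T hT => ?_) (fun T hT hT' => ?_)
    · simp only [Finset.mem_union, Finset.mem_powerset] at hT ⊢
      rcases hT with h | h
      · exact h.trans Finset.subset_union_left
      · exact h.trans Finset.subset_union_right
    · simp only [Finset.mem_union, Finset.mem_powerset, not_or] at hT hT'
      exact hF T hT hT'.1 hT'.2
  have h2 : A.powerset ∩ B.powerset = {∅} := by
    ext T
    simp only [Finset.mem_inter, Finset.mem_powerset, Finset.mem_singleton]
    refine ⟨fun hT => ?_, fun hT => by simp [hT]⟩
    exact Finset.subset_empty.1 (Finset.disjoint_iff_inter_eq_empty.1 hd ▸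
      Finset.subset_inter hT.1 hT.2)
  have h3 := Finset.sum_union_inter (s₁ := A.powerset) (s₂ := B.powerset) (f := F)
  rw [h1, h2, Finset.sum_singleton] at h3
  linarith

theorem shortfall_eq (S : Finset V) :
    shortfall G μ S = properShortfall G μ S + S.card * (μ - 1) := by
  classical
  unfold shortfall properShortfall
  rw [← Finset.sum_filter_add_sum_filter_not _ (fun T : Finset V => 2 ≤ T.card),
    Finset.filter_filter, Finset.filter_filter]
  congr 1
  have : {T ∈ S.powerset | Conn G T ∧ ¬ 2 ≤ T.card} = S.powersetCard 1 := by
    ext T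
    simp only [Finset.mem_filter, Finset.mem_powerset, Finset.mem_powersetCard]
    constructor
    · rintro ⟨h1, h2, h3⟩
      have := h2.nonempty.card_pos
      exact ⟨h1, by omega⟩
    · rintro ⟨h1, h2⟩
      obtain ⟨x, rfl⟩ := Finset.card_eq_one.1 h2
      exact ⟨h1, conn_singleton x, by simp⟩
  rw [this, Finset.sum_congr rfl (g := fun _ => μ - 1)]
  · rw [Finset.sum_const, Finset.card_powersetCard, Nat.choose_one_right, nsmul_eq_mul]
  · intro T hT
    rw [(Finset.mem_powersetCard.1 hT).2]; simp

theorem properShortfall_eq_zero_of_no_edges {A : Finset V} (hA : NoEdgesBetween G A A) :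
    properShortfall G μ A = 0 := by
  classical
  unfold properShortfall
  rw [Finset.filter_false_of_mem, Finset.sum_empty]
  rintro T hT ⟨hc, h2⟩
  obtain ⟨x, hx⟩ := hc.nonempty
  have hTA := Finset.mem_powerset.1 hT
  have hsplit : NoEdgesBetween G {x} (T \ {x}) := fun a ha b hb =>
    hA a (hTA (Finset.mem_singleton.1 ha ▸ hx)) b (hTA (Finset.mem_sdiff.1 hb).1)
  refine hsplit.not_conn Finset.disjoint_sdiff (by simp) ?_
    (by rwa [Finset.union_sdiff_of_subset (by simpa using hx)])
  rw [← Finset.card_pos, Finset.card_sdiff_of_subset (by simpa using hx)]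
  simp; omega

theorem properShortfall_eq_zero_of_card_le_one {A : Finset V} (hA : A.card ≤ 1) :
    properShortfall G μ A = 0 := by
  classical
  refine properShortfall_eq_zero_of_no_edges fun a ha b hb hab => hab.ne ?_
  exact Finset.card_le_one.1 hA a ha b hb

theorem shortfall_map {U : Type*} {H : SimpleGraph U} (f : H ↪g G) (S : Finset U) :
    shortfall G μ (S.map f.toEmbedding) = shortfall H μ S := by
  classical
  unfold shortfall
  symm
  refine Finset.sum_bij (fun T _ => T.map f.toEmbedding) ?_ ?_ ?_ ?_
  · intro T hT
    simp only [Finset.mem_filter, Finset.mem_powerset] at hT ⊢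
    exact ⟨Finset.map_subset_map.2 hT.1, (conn_map f T).2 hT.2⟩
  · intro T _ T' _ h
    exact Finset.map_injective _ h
  · intro T hT
    simp only [Finset.mem_filter, Finset.mem_powerset] at hT
    obtain ⟨T', hT', rfl⟩ := Finset.subset_map_iff.1 hT.1
    exact ⟨T', by simpa using ⟨hT', (conn_map f T').1 hT.2⟩, rfl⟩
  · intro T _
    simp

variable [DecidableEq V] {A B : Finset V}

theorem NoEdgesBetween.properShortfall_union (h : NoEdgesBetween G A B) (hd : Disjoint A B) :
    properShortfall G μ (A ∪ B) = properShortfall G μ A + properShortfall G μ B := by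
  classical
  unfold properShortfall
  simp only [Finset.sum_filter]
  rw [sum_powerset_union hd]
  · simp
  · intro T hT hA hB
    refine if_neg fun hc => ?_
    exact (h.subset_of_conn hT hc.1).elim hA hB

theorem NoEdgesBetween.shortfall_union (h : NoEdgesBetween G A B) (hd : Disjoint A B) :
    shortfall G μ (A ∪ B) = shortfall G μ A + shortfall G μ B := by
  simp only [shortfall_eq, h.properShortfall_union hd, Finset.card_union_of_disjoint hd]
  push_cast; ring

theorem AllEdgesBetween.properShortfall_union (h : AllEdgesBetween G A B) (hd : Disjoint A B) :
    properShortfall G μ (A ∪ B) =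
      crossShortfall μ A.card B.card + properShortfall G μ A + properShortfall G μ B := by
  classical
  have key := sum_powerset_union hd
    -- The weight of the proper connected sets minus the weight of all sets vanishes on crossing
    -- sets, so `sum_powerset_union` applies; the full sums are known in closed form.
    (fun T => (if Conn G T ∧ 2 ≤ T.card then (μ - T.card) else 0) - (μ - T.card)) (by
      intro T hT hA hB
      have hc := h.conn hT hA hB
      have h2 : 2 ≤ T.card := by
        obtain ⟨b, hbT, hbA⟩ := Finset.not_subset.1 hA
        obtain ⟨a, haT, haB⟩ := Finset.not_subset.1 hB
        have ha : a ∈ A := (Finset.mem_union.1 (hT haT)).resolve_right haB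
        exact Finset.one_lt_card.2 ⟨a, haT, b, hbT, fun e => hbA (e ▸ ha)⟩
      simp only [if_pos (And.intro hc h2), sub_self])
  simp only [Finset.sum_sub_distrib
    (f := fun T : Finset V => if Conn G T ∧ 2 ≤ T.card then (μ - T.card) else 0),
    sum_powerset_sub_card, ← Finset.sum_filter,
    Finset.card_union_of_disjoint hd] at key
  simp only [Finset.card_empty, Nat.cast_zero, sub_zero, show ¬ (2 ≤ 0) by omega, and_false,
    if_false] at key
  unfold properShortfall crossShortfall
  push_cast at key
  rw [pow_add] at key
  linear_combination key

/-- As a function of μ the sum is affine with slope the number of connected sets of order at least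
two. An edge makes this slope positive, which is what the equality cases use. -/
theorem properShortfall_add_const (μ ν : ℚ) (S : Finset V) :
    ∃ k : ℕ, properShortfall G μ S = properShortfall G ν S + k * (μ - ν) ∧
      (∀ x ∈ S, ∀ y ∈ S, G.Adj x y → 0 < k) := by
  classical
  refine ⟨{T ∈ S.powerset | Conn G T ∧ 2 ≤ T.card}.card, ?_, ?_⟩
  · unfold properShortfall
    rw [← nsmul_eq_mul, ← Finset.sum_const, ← Finset.sum_add_distrib]
    exact Finset.sum_congr rfl fun T _ => by ring
  · intro x hx y hy hxy
    refine Finset.card_pos.2 ⟨{x, y}, ?_⟩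
    simp only [Finset.mem_filter, Finset.mem_powerset]
    refine ⟨?_, (conn_pair hxy.ne).2 hxy, (Finset.card_pair hxy.ne).ge⟩
    intro z hz
    simp only [Finset.mem_insert, Finset.mem_singleton] at hz
    rcases hz with rfl | rfl <;> assumption

end Shortfall

/-! ### Lower bounds for cographs and reduction to complete bipartite graphs -/

theorem natCast_le_two_pow_sub_one (a : ℕ) : (a : ℚ) ≤ 2 ^ a - 1 := by
  have h : a + 1 ≤ 2 ^ a := Nat.lt_two_pow_self
  have : ((a + 1 : ℕ) : ℚ) ≤ ((2 ^ a : ℕ) : ℚ) := by exact_mod_cast h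
  push_cast at this
  linarith

section Bounds

variable {V : Type*} {G : SimpleGraph V} {μ : ℚ} [DecidableEq V]

theorem crossShortfall_nonneg {a b : ℕ} (h : ((a + b : ℕ) : ℚ) / 2 + 1 ≤ μ) :
    0 ≤ crossShortfall μ a b := by
  have ha := natCast_le_two_pow_sub_one a
  have hb := natCast_le_two_pow_sub_one b
  have ha0 : (0 : ℚ) ≤ a := by positivity
  have hb0 : (0 : ℚ) ≤ b := by positivity
  unfold crossShortfall
  push_cast at h
  set x : ℚ := 2 ^ a - 1
  set y : ℚ := 2 ^ b - 1
  have h1 : x * y * 1 ≤ x * y * (μ - (a + b) / 2) :=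
    mul_le_mul_of_nonneg_left (by linarith) (mul_nonneg (by linarith) (by linarith))
  have h2 : a * y ≤ x * y := mul_le_mul_of_nonneg_right ha (by linarith)
  have h3 : b * x ≤ y * x := mul_le_mul_of_nonneg_right hb (by linarith)
  linarith [mul_comm x y]

theorem PathFourFree.properShortfall_nonneg (hG : PathFourFree G) :
    ∀ (n : ℕ) (S : Finset V), S.card = n → (S.card : ℚ) / 2 + 1 ≤ μ →
      0 ≤ properShortfall G μ S := by
  intro n
  induction n using Nat.strong_induction_on with
  | _ n ih =>
    rintro S rfl hμ
    rcases Nat.lt_or_ge S.card 2 with h1 | h2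
    · rw [properShortfall_eq_zero_of_card_le_one (by omega)]
    obtain ⟨A, B, hA, hB, hd, rfl, h⟩ := hG.splits S h2
    have hc := Finset.card_union_of_disjoint hd
    have hA1 := hA.card_pos
    have hB1 := hB.card_pos
    have hμ' := hμ
    rw [hc] at hμ
    push_cast at hμ
    have gA := ih A.card (by omega) A rfl
      (by linarith [show (0 : ℚ) ≤ B.card by positivity])
    have gB := ih B.card (by omega) B rfl
      (by linarith [show (0 : ℚ) ≤ A.card by positivity])
    rcases h with h | h
    · rw [h.properShortfall_union hd]; linarith
    · rw [h.properShortfall_union hd]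
      rw [hc] at hμ'
      linarith [crossShortfall_nonneg hμ']

/-- The value at |S|/2 + 1 is already nonnegative, and an edge would make the function strictly
increasing beyond that point. -/
theorem PathFourFree.noEdgesBetween_of_properShortfall_eq_zero (hG : PathFourFree G) {S : Finset V}
    (hμ : (S.card : ℚ) / 2 + 1 < μ) (h0 : properShortfall G μ S = 0) :
    NoEdgesBetween G S S := by
  intro x hx y hy hxy
  obtain ⟨k, hk, hpos⟩ := properShortfall_add_const (G := G) μ ((S.card : ℚ) / 2 + 1) S
  have h1 := hG.properShortfall_nonneg (μ := (S.card : ℚ) / 2 + 1) _ S rfl le_rfl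
  have h2 : (0 : ℚ) < k := by exact_mod_cast hpos x hx y hy hxy
  have h3 := mul_pos h2 (sub_pos.2 hμ)
  linarith

/-- Equivalently, a cograph of order n has mean at most (n + 1)/2. In a join each side has at most
|S| - 1 vertices, so the sides satisfy the stronger threshold of `properShortfall_nonneg`. -/
theorem PathFourFree.shortfall_nonneg (hG : PathFourFree G) :
    ∀ (n : ℕ) (S : Finset V), S.card = n → 1 ≤ n → ((S.card : ℚ) + 1) / 2 ≤ μ →
      0 ≤ shortfall G μ S := by
  intro n
  induction n using Nat.strong_induction_on with
  | _ n ih =>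
    rintro S rfl hS hμ
    rcases Nat.lt_or_ge S.card 2 with h1 | h2
    · rw [shortfall_eq, properShortfall_eq_zero_of_card_le_one (by omega)]
      have : S.card = 1 := by omega
      rw [this] at hμ ⊢
      push_cast at *
      linarith
    obtain ⟨A, B, hA, hB, hd, rfl, h⟩ := hG.splits S h2
    have hc := Finset.card_union_of_disjoint hd
    have hA1 := hA.card_pos
    have hB1 := hB.card_pos
    have hA2 : (1 : ℚ) ≤ A.card := by exact_mod_cast hA1
    have hB2 : (1 : ℚ) ≤ B.card := by exact_mod_cast hB1
    rw [hc] at hμ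
    push_cast at hμ
    rcases h with h | h
    · rw [h.shortfall_union hd]
      have gA := ih A.card (by omega) A rfl (by omega) (by linarith)
      have gB := ih B.card (by omega) B rfl (by omega) (by linarith)
      linarith
    · rw [shortfall_eq, h.properShortfall_union hd, hc]
      have gA := hG.properShortfall_nonneg (μ := μ) _ A rfl (by linarith)
      have gB := hG.properShortfall_nonneg (μ := μ) _ B rfl (by linarith)
      have hx := natCast_le_two_pow_sub_one A.card
      have hy := natCast_le_two_pow_sub_one B.card
      unfold crossShortfall
      push_cast
      set a : ℚ := (A.card : ℚ)
      set b : ℚ := (B.card : ℚ)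
      set x : ℚ := 2 ^ A.card - 1
      set y : ℚ := 2 ^ B.card - 1
      have h1 : x * y * (1 / 2) ≤ x * y * (μ - (a + b) / 2) :=
        mul_le_mul_of_nonneg_left (by linarith) (mul_nonneg (by linarith) (by linarith))
      have h2 : (a + b) * ((a + b - 1) / 2) ≤ (a + b) * (μ - 1) :=
        mul_le_mul_of_nonneg_left (by linarith) (by linarith)
      nlinarith [mul_nonneg (sub_nonneg.2 hx) (sub_nonneg.2 hy),
        mul_nonneg (sub_nonneg.2 hA2) (sub_nonneg.2 hB2),
        mul_nonneg (sub_nonneg.2 hA2) (sub_nonneg.2 hA2),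
        mul_nonneg (sub_nonneg.2 hB2) (sub_nonneg.2 hB2)]

/-- `G` induces on `S` a complete bipartite graph with parts of orders `a` and `b`. -/
def IsCompleteBipartiteOn (G : SimpleGraph V) (S : Finset V) (a b : ℕ) : Prop :=
  ∃ A B : Finset V, A.card = a ∧ B.card = b ∧ Disjoint A B ∧ A ∪ B = S ∧
    AllEdgesBetween G A B ∧ NoEdgesBetween G A A ∧ NoEdgesBetween G B B

theorem IsCompleteBipartiteOn.symm {S : Finset V} {a b : ℕ} (h : IsCompleteBipartiteOn G S a b) :
    IsCompleteBipartiteOn G S b a := by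
  obtain ⟨A, B, hA, hB, hd, hu, h, h1, h2⟩ := h
  exact ⟨B, A, hB, hA, hd.symm, by rwa [Finset.union_comm], h.symm, h2, h1⟩

theorem IsCompleteBipartiteOn.properShortfall_eq {S : Finset V} {a b : ℕ}
    (h : IsCompleteBipartiteOn G S a b) : properShortfall G μ S = crossShortfall μ a b := by
  obtain ⟨A, B, rfl, rfl, hd, rfl, h, h1, h2⟩ := h
  rw [h.properShortfall_union hd, properShortfall_eq_zero_of_no_edges h1,
    properShortfall_eq_zero_of_no_edges h2]
  ring

/-- The lower bound by a complete bipartite graph holds for `S`. -/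
def BipartiteBound (G : SimpleGraph V) (μ : ℚ) (S : Finset V) : Prop :=
  ∃ a b : ℕ, 1 ≤ a ∧ 1 ≤ b ∧ a + b = S.card ∧ crossShortfall μ a b ≤ properShortfall G μ S ∧
    ((S.card : ℚ) / 2 < μ → properShortfall G μ S = crossShortfall μ a b →
      IsCompleteBipartiteOn G S a b)

theorem AllEdgesBetween.bipartiteBound {A B : Finset V} (h : AllEdgesBetween G A B)
    (hd : Disjoint A B) (hA : A.Nonempty) (hB : B.Nonempty)
    (gA : 0 ≤ properShortfall G μ A) (gB : 0 ≤ properShortfall G μ B)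
    (eA : ((A ∪ B).card : ℚ) / 2 < μ → properShortfall G μ A = 0 → NoEdgesBetween G A A)
    (eB : ((A ∪ B).card : ℚ) / 2 < μ → properShortfall G μ B = 0 → NoEdgesBetween G B B) :
    BipartiteBound G μ (A ∪ B) := by
  refine ⟨A.card, B.card, hA.card_pos, hB.card_pos, (Finset.card_union_of_disjoint hd).symm,
    ?_, fun hμ he => ?_⟩
  · rw [h.properShortfall_union hd]; linarith
  · rw [h.properShortfall_union hd] at he
    exact ⟨A, B, rfl, rfl, hd, rfl, h, eA hμ (by linarith), eB hμ (by linarith)⟩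

/-- If both sides have at least two vertices, each has at most |S| - 2, so μ ≥ |S|/2 reaches the
threshold |A|/2 + 1 on each side. -/
theorem PathFourFree.bipartiteBound_of_card (hG : PathFourFree G) {A B : Finset V}
    (h : AllEdgesBetween G A B) (hd : Disjoint A B) (hA : 2 ≤ A.card) (hB : 2 ≤ B.card)
    (hμ : ((A ∪ B).card : ℚ) / 2 ≤ μ) : BipartiteBound G μ (A ∪ B) := by
  have hA2 : (2 : ℚ) ≤ A.card := by exact_mod_cast hA
  have hB2 : (2 : ℚ) ≤ B.card := by exact_mod_cast hB
  have hc : ((A ∪ B).card : ℚ) = A.card + B.card := by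
    rw [Finset.card_union_of_disjoint hd]; push_cast; rfl
  refine h.bipartiteBound hd (Finset.card_pos.1 (by omega)) (Finset.card_pos.1 (by omega))
    (hG.properShortfall_nonneg _ A rfl (by linarith))
    (hG.properShortfall_nonneg _ B rfl (by linarith))
    (fun hμ h0 => hG.noEdgesBetween_of_properShortfall_eq_zero (by linarith) h0)
    (fun hμ h0 => hG.noEdgesBetween_of_properShortfall_eq_zero (by linarith) h0)

/-- Here B has |S| - 1 vertices and just misses the threshold, so it is split once more. -/
theorem PathFourFree.bipartiteBound_of_card_eq_one (hG : PathFourFree G) {A B : Finset V}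
    (h : AllEdgesBetween G A B) (hd : Disjoint A B) (hA : A.card = 1) (hB : 3 ≤ B.card)
    (hμ : ((A ∪ B).card : ℚ) / 2 ≤ μ) : BipartiteBound G μ (A ∪ B) := by
  have hc : ((A ∪ B).card : ℚ) = 1 + B.card := by
    rw [Finset.card_union_of_disjoint hd, hA]; push_cast; rfl
  have nA : A.Nonempty := Finset.card_pos.1 (by omega)
  have nB : B.Nonempty := Finset.card_pos.1 (by omega)
  obtain ⟨C, D, hC, hD, hd', rfl, h' | h'⟩ := hG.splits B (by omega)
  · have hcB : ((C ∪ D).card : ℚ) = C.card + D.card := by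
      rw [Finset.card_union_of_disjoint hd']; push_cast; rfl
    have hC2 : (1 : ℚ) ≤ C.card := by exact_mod_cast hC.card_pos
    have hD2 : (1 : ℚ) ≤ D.card := by exact_mod_cast hD.card_pos
    have gC := hG.properShortfall_nonneg (μ := μ) _ C rfl (by linarith)
    have gD := hG.properShortfall_nonneg (μ := μ) _ D rfl (by linarith)
    refine h.bipartiteBound hd nA nB
      (properShortfall_eq_zero_of_card_le_one hA.le).ge
      (by rw [h'.properShortfall_union hd']; linarith) (fun _ _ a ha b hb hab => hab.ne
        (Finset.card_le_one.1 hA.le a ha b hb)) (fun hμ h0 => ?_)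
    rw [h'.properShortfall_union hd'] at h0
    have eC := hG.noEdgesBetween_of_properShortfall_eq_zero (μ := μ) (S := C) (by linarith) (by linarith)
    have eD := hG.noEdgesBetween_of_properShortfall_eq_zero (μ := μ) (S := D) (by linarith) (by linarith)
    intro x hx y hy
    rcases Finset.mem_union.1 hx with hx | hx <;> rcases Finset.mem_union.1 hy with hy | hy
    · exact eC x hx y hy
    · exact h' x hx y hy
    · exact h'.symm x hx y hy
    · exact eD x hx y hy
  -- When B is itself a join of C and D, the single vertex is moved to the smaller side C. Both
  -- sides A ∪ C and D then have at least two vertices.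
  · wlog hDC : C.card ≤ D.card generalizing C D
    · rw [Finset.union_comm C D] at *
      exact this D C hD hC hd'.symm h hd hB hμ hc nB h'.symm (by omega)
    have hcd := Finset.card_union_of_disjoint hd'
    have hAC : Disjoint A C := hd.mono_right Finset.subset_union_left
    have hAD : Disjoint A D := hd.mono_right Finset.subset_union_right
    rw [← Finset.union_assoc] at hμ ⊢
    refine hG.bipartiteBound_of_card ?_ ?_ ?_ (by omega) hμ
    · intro x hx y hy
      rcases Finset.mem_union.1 hx with hx | hx
      · exact h x hx y (Finset.mem_union_right _ hy)
      · exact h' x hx y hy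
    · exact Finset.disjoint_union_left.2 ⟨hAD, hd'⟩
    · rw [Finset.card_union_of_disjoint hAC]
      have := hC.card_pos
      omega

theorem PathFourFree.bipartiteBound (hG : PathFourFree G) {S : Finset V} (hS : 4 ≤ S.card)
    (hc : Conn G S) (hμ : (S.card : ℚ) / 2 ≤ μ) : BipartiteBound G μ S := by
  obtain ⟨A, B, hA, hB, hd, rfl, h | h⟩ := hG.splits S (by omega)
  · exact absurd hc (h.not_conn hd hA hB)
  · have hcard := Finset.card_union_of_disjoint hd
    have hA1 := hA.card_pos
    have hB1 := hB.card_pos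
    by_cases hA2 : A.card = 1
    · exact hG.bipartiteBound_of_card_eq_one h hd hA2 (by omega) hμ
    by_cases hB2 : B.card = 1
    · rw [Finset.union_comm] at hμ ⊢
      exact hG.bipartiteBound_of_card_eq_one h.symm hd.symm hB2 (by omega) hμ
    exact hG.bipartiteBound_of_card h hd (by omega) (by omega) hμ

end Bounds

/-! ### Comparison of complete bipartite graphs -/

section Numerics

theorem four_mul_le_two_pow {b : ℕ} (hb : 4 ≤ b) : 4 * (b : ℚ) ≤ 2 ^ b := by
  induction b, hb using Nat.le_induction with
  | base => norm_num
  | succ b hb ih =>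
    have : (4 : ℚ) ≤ b := by exact_mod_cast hb
    rw [pow_succ]; push_cast; linarith

theorem five_mul_add_le_two_pow {b : ℕ} (hb : 5 ≤ b) : 5 * (b : ℚ) + 7 ≤ 2 ^ b := by
  induction b, hb using Nat.le_induction with
  | base => norm_num
  | succ b hb ih =>
    have : (5 : ℚ) ≤ b := by exact_mod_cast hb
    rw [pow_succ]; push_cast; linarith

theorem quadratic_le_two_pow {r : ℕ} (hr : 6 ≤ r) :
    5 * ((r : ℚ) + 1) ^ 2 - 8 * (r + 1) ≤ 3 * 2 ^ r := by
  induction r, hr using Nat.le_induction with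
  | base => norm_num
  | succ r hr ih =>
    have : (6 : ℚ) ≤ r := by exact_mod_cast hr
    rw [pow_succ (2 : ℚ)]; push_cast; nlinarith

/-- The right-hand side is 20 times the difference between K_{a,b} and the star in `crossShortfall`
at μ = (a + b)/2 + 1/5. -/
theorem star_inequality {a b : ℕ} (ha : 2 ≤ a) (hab : a ≤ b) (h : 7 ≤ a + b) {x y : ℚ}
    (hx : x = 2 ^ a - 1) (hy : y = 2 ^ b - 1) :
    0 < 7 * (x * y) - 10 * a * y - 10 * b * x + 3 * x + 3 * y - 13 + 10 * (a + b) := by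
  rcases Nat.lt_or_ge a 4 with ha4 | ha4
  · interval_cases a
    · have := five_mul_add_le_two_pow (b := b) (by omega)
      norm_num at hx
      subst hx
      push_cast
      linarith
    · have := four_mul_le_two_pow (b := b) (by omega)
      norm_num at hx
      subst hx
      have : (4 : ℚ) ≤ b := by exact_mod_cast (show 4 ≤ b by omega)
      push_cast
      linarith
  · have hx' := four_mul_le_two_pow ha4
    have hy' := four_mul_le_two_pow (ha4.trans hab)
    have ha' : (4 : ℚ) ≤ a := by exact_mod_cast ha4
    have hb' : (4 : ℚ) ≤ b := by exact_mod_cast ha4.trans hab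
    have h1 : 0 ≤ (x - 15 / 4 * a) * y := mul_nonneg (by linarith) (by linarith)
    have h2 : 0 ≤ (y - 15 / 4 * b) * x := mul_nonneg (by linarith) (by linarith)
    have h3 : 0 ≤ x * y := mul_nonneg (by linarith) (by linarith)
    nlinarith

theorem star_lt_crossShortfall {a b : ℕ} (ha : 2 ≤ a) (hb : 2 ≤ b) (h : 7 ≤ a + b) {μ : ℚ}
    (hμ : ((a + b : ℕ) : ℚ) / 2 + 1 / 5 ≤ μ) :
    crossShortfall μ 1 (a + b - 1) < crossShortfall μ a b := by
  wlog hab : a ≤ b generalizing a b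
  · rw [add_comm a b] at *
    rw [crossShortfall_comm μ a b]
    exact this hb ha h hμ (by omega)
  have key := star_inequality ha hab h rfl rfl
  have hx := natCast_le_two_pow_sub_one a
  have hy := natCast_le_two_pow_sub_one b
  have ha' : (2 : ℚ) ≤ a := by exact_mod_cast ha
  have hb' : (2 : ℚ) ≤ b := by exact_mod_cast hb
  obtain ⟨r, hr⟩ : ∃ r, a + b = r + 1 := ⟨a + b - 1, by omega⟩
  have hr' : (a : ℚ) + b = r + 1 := by exact_mod_cast hr
  have hpow : (2 : ℚ) ^ r * 2 = 2 ^ a * 2 ^ b := by rw [← pow_add, hr, pow_succ]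
  unfold crossShortfall
  rw [hr, Nat.add_sub_cancel]
  push_cast at *
  set x : ℚ := 2 ^ a - 1 with hxd
  set y : ℚ := 2 ^ b - 1 with hyd
  have hX : (2 : ℚ) ^ a = x + 1 := by rw [hxd]; ring
  have hY : (2 : ℚ) ^ b = y + 1 := by rw [hyd]; ring
  have hR : (2 : ℚ) ^ r = (x + 1) * (y + 1) / 2 := by rw [← hX, ← hY]; linarith
  rw [hR]
  -- K_{a,b} has at least as many crossing sets as the star, so the difference does not decrease as
  -- μ grows past (a + b)/2 + 1/5.
  have h0 : 0 ≤ (x * y - ((x + 1) * (y + 1) / 2 - 1)) * (μ - (a + b) / 2 - 1 / 5) := by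
    refine mul_nonneg ?_ (by linarith)
    nlinarith [mul_nonneg (show 0 ≤ x - 2 by linarith) (show 0 ≤ y - 2 by linarith)]
  have hrr : (r : ℚ) = a + b - 1 := by linarith
  rw [hrr]
  nlinarith

/-- The order of a smaller part of the complete bipartite graph of order `m` with maximum
mean. -/
def optimalSide (m : ℕ) : ℕ := if m ≤ 6 then 2 else 1

/-- The hypothesis makes μ the mean of the optimal graph (δ = 0) or of its union with an isolated
vertex (δ = 1), so one comparison serves both parts of the theorem. -/
theorem crossShortfall_optimalSide_le {m : ℕ} (hm : 4 ≤ m) {μ δ : ℚ} (hδ : δ = 0 ∨ δ = 1)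
    (h : crossShortfall μ (optimalSide m) (m - optimalSide m) + (m + δ) * (μ - 1) = 0) :
    (m : ℚ) / 2 < μ ∧ ∀ a b : ℕ, 1 ≤ a → 1 ≤ b → a + b = m →
      crossShortfall μ (optimalSide m) (m - optimalSide m) ≤ crossShortfall μ a b ∧
      (crossShortfall μ a b = crossShortfall μ (optimalSide m) (m - optimalSide m) →
        a = optimalSide m ∨ b = optimalSide m) := by
  rcases Nat.lt_or_ge m 7 with h7 | h7
  · have h2 : optimalSide m = 2 := if_pos (by omega)
    rw [h2] at h ⊢
    have hδ0 : 0 ≤ δ := by rcases hδ with rfl | rfl <;> norm_num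
    -- The upper bounds are the values of μ at which the star overtakes K_{2,m-2}. For m = 6 the
    -- competitor K_{3,3} is excluded by μ > 3.
    have hμ : (m : ℚ) / 2 < μ ∧ (m = 4 → μ < 5 / 2) ∧ (m = 5 → μ < 5 / 2 + 1 / 3) ∧
        (m = 6 → μ < 3 + 3 / 14) := by
      unfold crossShortfall at h
      rcases hδ with rfl | rfl <;> interval_cases m <;> norm_num at h ⊢ <;>
        (constructor <;> linarith)
    refine ⟨hμ.1, fun a b ha hb hab => ?_⟩
    obtain ⟨h0, h4, h5, h6⟩ := hμ
    have hle : ∀ a b : ℕ, 1 ≤ a → a ≤ b → a + b = m →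
        a = 2 ∨ crossShortfall μ 2 (m - 2) < crossShortfall μ a b := by
      clear h hab ha hb a b
      intro a b ha hab hs
      by_cases ha2 : a = 2
      · exact Or.inl ha2
      right
      obtain rfl : b = m - a := by omega
      have : a ≤ 3 := by omega
      unfold crossShortfall
      interval_cases m <;> interval_cases a <;> first | omega | (norm_num at h0 h4 h5 h6 ⊢; linarith)
    rcases le_total a b with hl | hl
    · rcases hle a b ha hl hab with rfl | hlt
      · obtain rfl : b = m - 2 := by omega
        exact ⟨le_rfl, fun _ => Or.inl rfl⟩
      · exact ⟨hlt.le, fun e => absurd e hlt.ne'⟩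
    · rw [crossShortfall_comm μ a b]
      rcases hle b a hb hl (by omega) with rfl | hlt
      · obtain rfl : a = m - 2 := by omega
        exact ⟨le_rfl, fun _ => Or.inr rfl⟩
      · exact ⟨hlt.le, fun e => absurd e hlt.ne'⟩
  · have h1 : optimalSide m = 1 := if_neg (by omega)
    rw [h1] at h ⊢
    -- Below m/2 + 1/5 the left side of `h` would be negative; for δ = 1 this is what
    -- `quadratic_le_two_pow` says.
    have hμ : (m : ℚ) / 2 + 1 / 5 ≤ μ := by
      obtain ⟨r, rfl⟩ : ∃ r, m = r + 1 := ⟨m - 1, by omega⟩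
      have hq := quadratic_le_two_pow (r := r) (by omega)
      have hr : (6 : ℚ) ≤ r := by exact_mod_cast (show 6 ≤ r by omega)
      have hp := natCast_le_two_pow_sub_one r
      by_contra! hlt
      unfold crossShortfall at h
      rw [Nat.add_sub_cancel] at h
      push_cast at h hlt
      have hpos : 0 < (2 : ℚ) ^ r - 1 + (r + 1 + δ) := by
        rcases hδ with rfl | rfl <;> linarith
      have := mul_pos hpos (sub_pos.2 hlt)
      rcases hδ with rfl | rfl <;> nlinarith
    refine ⟨by linarith, fun a b ha hb hab => ?_⟩
    subst hab
    by_cases ha1 : a = 1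
    · subst ha1
      rw [Nat.add_sub_cancel_left]
      exact ⟨le_rfl, fun _ => Or.inl rfl⟩
    by_cases hb1 : b = 1
    · subst hb1
      rw [Nat.add_sub_cancel, crossShortfall_comm]
      exact ⟨le_rfl, fun _ => Or.inr rfl⟩
    have hlt := star_lt_crossShortfall (a := a) (b := b) (by omega) (by omega) h7 hμ
    exact ⟨hlt.le, fun e => absurd e hlt.ne'⟩

end Numerics

/-! ### The mean as the zero of the shortfall -/

section GlobalMean

variable {V : Type*} {G : SimpleGraph V} {μ : ℚ}

open scoped Classical in
theorem sum_connInducedCount_mul [Fintype V] (w : ℕ → ℚ) :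
    ∑ k ∈ Finset.Icc 1 (Fintype.card V), (connInducedCount G k : ℚ) * w k =
      ∑ T ∈ (Finset.univ : Finset V).powerset with Conn G T, w T.card := by
  rw [← Finset.sum_fiberwise_of_maps_to (g := Finset.card) (t := Finset.Icc 1 (Fintype.card V))]
  · refine Finset.sum_congr rfl fun k _ => ?_
    rw [Finset.sum_congr rfl (g := fun _ => w k), Finset.sum_const, nsmul_eq_mul]
    · congr 2
      unfold connInducedCount
      rw [← Set.ncard_coe_finset]
      congr 1
      ext S
      simp [Conn, and_comm]
    · intro T hT
      rw [(Finset.mem_filter.1 hT).2]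
  · intro T hT
    have := (Finset.mem_filter.1 hT).2.nonempty.card_pos
    exact Finset.mem_Icc.2 ⟨this, Finset.card_le_univ T⟩

open scoped Classical in
theorem globalMean_eq [Fintype V] :
    globalMean G = (∑ T ∈ (Finset.univ : Finset V).powerset with Conn G T, (T.card : ℚ)) /
      ({T ∈ (Finset.univ : Finset V).powerset | Conn G T}.card : ℚ) := by
  unfold globalMean connInducedPoly
  congr 1
  · rw [← sum_connInducedCount_mul (fun k => (k : ℚ))]
    simp [Polynomial.eval_finsetSum, Polynomial.derivative_X_pow]
  · rw [Finset.card_eq_sum_ones]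
    push_cast
    rw [← sum_connInducedCount_mul (fun _ => 1)]
    simp [Polynomial.eval_finsetSum]

theorem shortfall_univ_eq [Fintype V] [Nonempty V] :
    ∃ N : ℚ, 0 < N ∧ ∀ μ, shortfall G μ Finset.univ = N * (μ - globalMean G) := by
  classical
  have hpos : 0 < ({T ∈ (Finset.univ : Finset V).powerset | Conn G T}.card : ℚ) := by
    obtain ⟨x⟩ := ‹Nonempty V›
    exact_mod_cast Finset.card_pos.2 ⟨{x}, by simpa using conn_singleton x⟩
  refine ⟨_, hpos, fun μ => ?_⟩
  rw [globalMean_eq, mul_sub, mul_div_cancel₀ _ hpos.ne']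
  unfold shortfall
  rw [Finset.sum_sub_distrib (f := fun _ : Finset V => μ), Finset.sum_const, nsmul_eq_mul]

theorem shortfall_globalMean [Fintype V] [Nonempty V] :
    shortfall G (globalMean G) Finset.univ = 0 := by
  obtain ⟨N, -, h⟩ := shortfall_univ_eq (G := G)
  rw [h, sub_self, mul_zero]

theorem globalMean_le_iff [Fintype V] [Nonempty V] :
    globalMean G ≤ μ ↔ 0 ≤ shortfall G μ Finset.univ := by
  obtain ⟨N, hN, h⟩ := shortfall_univ_eq (G := G)
  rw [h, mul_nonneg_iff_of_pos_left hN, sub_nonneg]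

theorem shortfall_univ_iso [Fintype V] {W : Type*} [Fintype W] {H : SimpleGraph W}
    (e : G ≃g H) (μ : ℚ) : shortfall G μ Finset.univ = shortfall H μ Finset.univ := by
  rw [← shortfall_map e.toEmbedding Finset.univ]
  congr 1
  ext w
  simp only [Finset.mem_map, Finset.mem_univ, true_and, iff_true]
  exact ⟨e.symm w, e.apply_symm_apply w⟩

theorem globalMean_iso [Fintype V] [Nonempty V] {W : Type*} [Fintype W] {H : SimpleGraph W}
    (e : G ≃g H) : globalMean G = globalMean H := by
  have : Nonempty W := e.toEquiv.nonempty_congr.1 ‹_›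
  refine le_antisymm (globalMean_le_iff.2 ?_) (globalMean_le_iff.2 ?_)
  · rw [shortfall_univ_iso e, shortfall_globalMean]
  · rw [← shortfall_univ_iso e, shortfall_globalMean]

end GlobalMean

theorem PathFourFree.of_embedding {V W : Type*} {G : SimpleGraph V} {H : SimpleGraph W}
    (hG : PathFourFree G) (f : H ↪g G) : PathFourFree H := by
  intro a b c d
  simpa only [f.map_adj_iff] using hG (f a) (f b) (f c) (f d)

/-! ### Orders at most three -/

section Complete

variable {V : Type*} {G : SimpleGraph V} {μ : ℚ}

theorem conn_of_forall_adj {S T : Finset V} (h : ∀ x ∈ S, ∀ y ∈ S, x ≠ y → G.Adj x y)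
    (hT : T ⊆ S) (hne : T.Nonempty) : Conn G T := by
  obtain ⟨x, hx⟩ := hne
  unfold Conn
  rw [SimpleGraph.connected_iff_exists_forall_reachable]
  refine ⟨⟨x, hx⟩, ?_⟩
  rintro ⟨y, hy⟩
  by_cases hxy : x = y
  · subst hxy; rfl
  · exact (show (G.induce (T : Set V)).Adj ⟨x, hx⟩ ⟨y, hy⟩ from
      h x (hT hx) y (hT hy) hxy).reachable

open scoped Classical in
theorem shortfall_add_sum_not_conn (S : Finset V) :
    shortfall G μ S + ∑ T ∈ S.powerset.erase ∅ with ¬ Conn G T, (μ - T.card) =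
      2 ^ S.card * (μ - S.card / 2) - μ := by
  rw [← sum_powerset_sub_card, ← Finset.add_sum_erase _ _ (Finset.empty_mem_powerset S),
    ← Finset.sum_filter_add_sum_filter_not (S.powerset.erase ∅) (fun T => Conn G T)]
  unfold shortfall
  have : {T ∈ S.powerset.erase ∅ | Conn G T} = {T ∈ S.powerset | Conn G T} := by
    ext T
    simp only [Finset.mem_filter, Finset.mem_erase, Finset.mem_powerset]
    exact ⟨fun h => ⟨h.1.2, h.2⟩, fun h => ⟨⟨h.2.nonempty.ne_empty, h.1⟩, h.2⟩⟩
  rw [this]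
  simp only [Finset.card_empty, Nat.cast_zero]
  ring

theorem shortfall_of_forall_adj {S : Finset V} (h : ∀ x ∈ S, ∀ y ∈ S, x ≠ y → G.Adj x y) :
    shortfall G μ S = 2 ^ S.card * (μ - S.card / 2) - μ := by
  classical
  rw [← shortfall_add_sum_not_conn (G := G), Finset.filter_false_of_mem, Finset.sum_empty,
    add_zero]
  intro T hT
  simp only [Finset.mem_erase, Finset.mem_powerset] at hT
  exact not_not.2 (conn_of_forall_adj h hT.2 (Finset.nonempty_iff_ne_empty.2 hT.1))

/-- A nonempty disconnected subset of such an S has exactly two vertices. Each one raises the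
shortfall by 2 - μ > 0 relative to the complete graph. -/
theorem Conn.le_shortfall_of_card_le_three {S : Finset V} (hc : Conn G S) (hS : S.card ≤ 3)
    (hμ : μ < 2) :
    2 ^ S.card * (μ - S.card / 2) - μ ≤ shortfall G μ S ∧
      (shortfall G μ S = 2 ^ S.card * (μ - S.card / 2) - μ →
        ∀ x ∈ S, ∀ y ∈ S, x ≠ y → G.Adj x y) := by
  classical
  have key := shortfall_add_sum_not_conn (G := G) (μ := μ) S
  rw [Finset.sum_congr rfl (g := fun _ => μ - 2), Finset.sum_const, nsmul_eq_mul] at key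
  · refine ⟨?_, fun he x hx y hy hxy => ?_⟩
    · have := mul_nonneg (Nat.cast_nonneg (α := ℚ)
        {T ∈ S.powerset.erase ∅ | ¬ Conn G T}.card) (show 0 ≤ 2 - μ by linarith)
      linarith
    · by_contra hn
      have hpos : 0 < {T ∈ S.powerset.erase ∅ | ¬ Conn G T}.card := by
        refine Finset.card_pos.2 ⟨{x, y}, ?_⟩
        simp only [Finset.mem_filter, Finset.mem_erase, Finset.mem_powerset, conn_pair hxy]
        refine ⟨⟨Finset.insert_ne_empty _ _, ?_⟩, hn⟩
        intro z hz
        simp only [Finset.mem_insert, Finset.mem_singleton] at hz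
        rcases hz with rfl | rfl <;> assumption
      have := mul_pos (Nat.cast_pos (α := ℚ).2 hpos) (show 0 < 2 - μ by linarith)
      linarith
  · intro T hT
    simp only [Finset.mem_filter, Finset.mem_erase, Finset.mem_powerset] at hT
    obtain ⟨⟨hne, hTS⟩, hn⟩ := hT
    have h0 := Finset.card_pos.2 (Finset.nonempty_iff_ne_empty.2 hne)
    have h1 : T.card ≠ 1 := fun h => by
      obtain ⟨x, rfl⟩ := Finset.card_eq_one.1 h
      exact hn (conn_singleton x)
    have h3 : T.card < S.card := Finset.card_lt_card
      (Finset.ssubset_iff_subset_ne.2 ⟨hTS, fun e => hn (e ▸ hc)⟩)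
    rw [show T.card = 2 by omega]
    norm_num

end Complete

/-! ### The extremal connected cograph and its uniqueness -/

section Optimal

/-- The complete bipartite graph on `Fin m` whose parts are the first `s` and the remaining
vertices. -/
def bipartiteFin (s m : ℕ) : SimpleGraph (Fin m) where
  Adj i j := ¬ ((i : ℕ) < s ↔ (j : ℕ) < s)
  symm := ⟨fun _ _ h h' => h h'.symm⟩
  loopless := ⟨fun _ h => h Iff.rfl⟩

/-- The connected cograph of order `m` with maximum mean. -/
def optimalGraph (m : ℕ) : SimpleGraph (Fin m) :=
  if m ≤ 3 then ⊤ else bipartiteFin (optimalSide m) m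

theorem isCompleteBipartiteOn_bipartiteFin {s m : ℕ} (hs : s ≤ m) :
    IsCompleteBipartiteOn (bipartiteFin s m) Finset.univ s (m - s) := by
  have h1 : (Finset.univ.filter fun i : Fin m => (i : ℕ) < s).card = s := by
    rw [Fin.card_filter_val_lt]; omega
  refine ⟨Finset.univ.filter fun i => (i : ℕ) < s, Finset.univ.filter fun i => ¬ (i : ℕ) < s,
    h1, ?_, Finset.disjoint_filter_filter_not _ _ _, Finset.filter_union_filter_not_eq _ _,
    ?_, ?_, ?_⟩
  · have := Finset.card_filter_add_card_filter_not (s := (Finset.univ : Finset (Fin m)))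
      (fun i => (i : ℕ) < s)
    rw [h1, Finset.card_univ, Fintype.card_fin] at this
    omega
  all_goals
    intro a ha b hb
    simp only [Finset.mem_filter, Finset.mem_univ, true_and] at ha hb
    simp [bipartiteFin, ha, hb]

theorem IsCompleteBipartiteOn.nonempty_iso {V : Type*} [Fintype V] [DecidableEq V]
    {G : SimpleGraph V} {s b m : ℕ} (hm : Fintype.card V = m)
    (h : IsCompleteBipartiteOn G Finset.univ s b) : Nonempty (G ≃g bipartiteFin s m) := by
  obtain ⟨A, B, hA, hB, hd, hu, hAB, hAA, hBB⟩ := h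
  have hmem : ∀ x, x ∉ A → x ∈ B := fun x hx =>
    (Finset.mem_union.1 (hu ▸ Finset.mem_univ x)).resolve_left hx
  have hsm : s ≤ m := by rw [← hA, ← hm]; exact Finset.card_le_univ A
  have c1 : Fintype.card {x // x ∈ A} = Fintype.card {i : Fin m // (i : ℕ) < s} := by
    rw [Fintype.card_coe, hA, Fintype.card_subtype, Fin.card_filter_val_lt]; omega
  have c2 : Fintype.card {x // ¬ x ∈ A} = Fintype.card {i : Fin m // ¬ (i : ℕ) < s} := by
    rw [Fintype.card_subtype_compl, Fintype.card_subtype_compl, c1, hm, Fintype.card_fin]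
  let e : V ≃ Fin m := (Equiv.sumCompl (· ∈ A)).symm.trans
    ((Equiv.sumCongr (Fintype.equivOfCardEq c1) (Fintype.equivOfCardEq c2)).trans
      (Equiv.sumCompl (fun i : Fin m => (i : ℕ) < s)))
  have he : ∀ x, (e x : ℕ) < s ↔ x ∈ A := by
    intro x
    by_cases hx : x ∈ A
    · have : e x = (Fintype.equivOfCardEq c1 ⟨x, hx⟩ : {i : Fin m // (i : ℕ) < s}) := by
        simp [e, Equiv.sumCompl_symm_apply_of_pos hx]
      rw [this]
      exact iff_of_true (Fintype.equivOfCardEq c1 ⟨x, hx⟩).2 hx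
    · have : e x = (Fintype.equivOfCardEq c2 ⟨x, hx⟩ : {i : Fin m // ¬ (i : ℕ) < s}) := by
        simp [e, Equiv.sumCompl_symm_apply_of_neg hx]
      rw [this]
      exact iff_of_false (Fintype.equivOfCardEq c2 ⟨x, hx⟩).2 hx
  refine ⟨⟨e, fun {x y} => ?_⟩⟩
  change ¬ ((e x : ℕ) < s ↔ (e y : ℕ) < s) ↔ G.Adj x y
  rw [he, he]
  by_cases hx : x ∈ A <;> by_cases hy : y ∈ A
  · simp [hx, hy, hAA x hx y hy]
  · simp [hx, hy, hAB x hx y (hmem y hy)]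
  · simp [hx, hy, (hAB y hy x (hmem x hx)).symm]
  · simp [hx, hy, hBB x (hmem x hx) y (hmem y hy)]

theorem optimalSide_pos (m : ℕ) : 1 ≤ optimalSide m := by
  unfold optimalSide; split <;> omega

theorem optimalSide_le_two (m : ℕ) : optimalSide m ≤ 2 := by
  unfold optimalSide; split <;> omega

theorem pathFourFree_optimalGraph (m : ℕ) : PathFourFree (optimalGraph m) := by
  unfold optimalGraph
  split
  · intro a b c d _ _ hcd
    by_cases hac : a = c
    · subst hac; exact Or.inr (Or.inr hcd)
    · exact Or.inl hac
  · intro a b c d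
    simp only [bipartiteFin]
    tauto

theorem connected_optimalGraph {m : ℕ} (hm : 1 ≤ m) : (optimalGraph m).Connected := by
  have : Nonempty (Fin m) := ⟨⟨0, hm⟩⟩
  unfold optimalGraph
  split
  · exact SimpleGraph.connected_top
  · have h2 := optimalSide_le_two m
    obtain ⟨A, B, hA, hB, hd, hu, h, -, -⟩ :=
      isCompleteBipartiteOn_bipartiteFin (s := optimalSide m) (m := m) (by omega)
    rw [← conn_univ, ← hu]
    have h1 := optimalSide_pos m
    exact h.conn_union hd (Finset.card_pos.1 (by omega)) (Finset.card_pos.1 (by omega))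

theorem shortfall_optimalGraph_of_le_three {m : ℕ} (hm : m ≤ 3) (μ : ℚ) :
    shortfall (optimalGraph m) μ Finset.univ = 2 ^ m * (μ - m / 2) - μ := by
  rw [shortfall_of_forall_adj, Finset.card_univ, Fintype.card_fin]
  intro x _ y _ hxy
  rw [optimalGraph, if_pos hm]
  exact hxy

theorem shortfall_optimalGraph_of_four_le {m : ℕ} (hm : 4 ≤ m) (μ : ℚ) :
    shortfall (optimalGraph m) μ Finset.univ =
      crossShortfall μ (optimalSide m) (m - optimalSide m) + m * (μ - 1) := by
  have h2 := optimalSide_le_two m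
  rw [shortfall_eq, optimalGraph, if_neg (by omega),
    (isCompleteBipartiteOn_bipartiteFin (by omega)).properShortfall_eq, Finset.card_univ,
    Fintype.card_fin]

theorem shortfall_optimalGraph_le {m : ℕ} (hm : 1 ≤ m) {μ δ : ℚ} (hδ : δ = 0 ∨ δ = 1)
    (h : shortfall (optimalGraph m) μ Finset.univ + δ * (μ - 1) = 0) :
    (m : ℚ) / 2 ≤ μ ∧ ∀ {V : Type u} {G : SimpleGraph V}, PathFourFree G → ∀ S : Finset V,
      S.card = m → Conn G S →
        shortfall (optimalGraph m) μ Finset.univ ≤ shortfall G μ S ∧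
        ∀ [Fintype V], S = Finset.univ →
          shortfall G μ S = shortfall (optimalGraph m) μ Finset.univ →
          Nonempty (G ≃g optimalGraph m) := by
  classical
  rcases Nat.lt_or_ge m 4 with h4 | h4
  · rw [shortfall_optimalGraph_of_le_three (by omega)] at h ⊢
    have hμ : (m : ℚ) / 2 ≤ μ ∧ μ < 2 := by
      rcases hδ with rfl | rfl <;> interval_cases m <;> norm_num at h ⊢ <;>
        constructor <;> linarith
    refine ⟨hμ.1, ?_⟩
    rintro V G hG S rfl hc
    obtain ⟨h1, h2⟩ := hc.le_shortfall_of_card_le_three (μ := μ) (by omega) hμ.2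
    refine ⟨h1, ?_⟩
    rintro _ rfl he
    have e := Fintype.equivFinOfCardEq (α := V) Finset.card_univ.symm
    refine ⟨⟨e, fun {x y} => ?_⟩⟩
    rw [optimalGraph, if_pos (by omega), SimpleGraph.top_adj, e.injective.ne_iff]
    exact ⟨h2 he x (Finset.mem_univ x) y (Finset.mem_univ y), fun hxy => hxy.ne⟩
  · rw [shortfall_optimalGraph_of_four_le h4] at h ⊢
    obtain ⟨hμ, hJ⟩ := crossShortfall_optimalSide_le h4 hδ (by linarith)
    refine ⟨hμ.le, ?_⟩
    rintro V G hG S rfl hc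
    obtain ⟨a, b, ha, hb, hab, hle, heq⟩ := hG.bipartiteBound h4 hc hμ.le
    obtain ⟨hJ1, hJ2⟩ := hJ a b ha hb hab
    rw [shortfall_eq]
    refine ⟨by linarith, ?_⟩
    rintro _ rfl he
    have hbip := heq hμ (by linarith)
    rw [optimalGraph, if_neg (by omega)]
    rcases hJ2 (by linarith) with h1 | h1
    · exact (h1 ▸ hbip).nonempty_iso Finset.card_univ.symm
    · exact (h1 ▸ hbip.symm).nonempty_iso Finset.card_univ.symm

theorem globalMean_le_optimalGraph {m : ℕ} (hm : 1 ≤ m) {V : Type u} [Fintype V]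
    {G : SimpleGraph V} (hV : Fintype.card V = m) (hG : IsCograph G) (hc : G.Connected) :
    globalMean G ≤ globalMean (optimalGraph m) ∧
      (globalMean G = globalMean (optimalGraph m) → Nonempty (G ≃g optimalGraph m)) := by
  have : Nonempty (Fin m) := ⟨⟨0, hm⟩⟩
  have : Nonempty V := hc.nonempty
  have h0 := shortfall_globalMean (G := optimalGraph m)
  obtain ⟨h1, h2⟩ := (shortfall_optimalGraph_le hm (μ := globalMean (optimalGraph m))
    (Or.inl rfl) (by rw [h0]; ring)).2 hG.pathFourFree Finset.univ
      (by rwa [Finset.card_univ]) (conn_univ.2 hc)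
  refine ⟨globalMean_le_iff.2 (h0 ▸ h1), fun he => h2 rfl ?_⟩
  rw [h0, ← he, shortfall_globalMean]

theorem isMaxMeanConnectedCograph_of_iso {m : ℕ} (hm : 1 ≤ m) {W : Type v} [Fintype W]
    {Q : SimpleGraph W} (e : Q ≃g optimalGraph m) : IsMaxMeanConnectedCograph Q := by
  have : Nonempty W := ⟨e.symm ⟨0, hm⟩⟩
  refine ⟨((pathFourFree_optimalGraph m).of_embedding e.toEmbedding).isCograph,
    e.connected_iff.2 (connected_optimalGraph hm), fun H hH hHc => ?_⟩
  rw [globalMean_iso e]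
  refine (globalMean_le_optimalGraph hm ?_ hH hHc).1
  rw [Fintype.card_congr e.toEquiv, Fintype.card_fin]

theorem IsMaxMeanConnectedCograph.nonempty_iso {m : ℕ} (hm : 1 ≤ m) {W : Type v} [Fintype W]
    {Q : SimpleGraph W} (hW : Fintype.card W = m) (hQ : IsMaxMeanConnectedCograph Q) :
    Nonempty (Q ≃g optimalGraph m) := by
  obtain ⟨h1, h2⟩ := globalMean_le_optimalGraph hm hW hQ.1 hQ.2.1
  have : Nonempty W := hQ.2.1.nonempty
  refine h2 (le_antisymm h1 ?_)
  -- Maximality of Q only concerns graphs on W, so the optimal graph is copied onto W.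
  let f : W ≃ Fin m := Fintype.equivFinOfCardEq hW
  have e : (optimalGraph m).comap f ≃g optimalGraph m := SimpleGraph.Iso.comap f _
  have hmax := isMaxMeanConnectedCograph_of_iso hm e
  rw [← globalMean_iso e]
  exact hQ.2.2 _ hmax.1 hmax.2.1

end Optimal

/-! ### Disconnected cographs -/

section Disconnected

variable {W : Type v}

theorem noEdgesBetween_sum [Fintype W] (Q : SimpleGraph W) :
    NoEdgesBetween (graphK1.sum Q)
      (Finset.univ.map (SimpleGraph.Embedding.sumInl (G := graphK1) (H := Q)).toEmbedding)
      (Finset.univ.map (SimpleGraph.Embedding.sumInr (G := graphK1) (H := Q)).toEmbedding) := by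
  intro a ha b hb
  simp only [Finset.mem_map, Finset.mem_univ, true_and] at ha hb
  obtain ⟨x, rfl⟩ := ha
  obtain ⟨y, rfl⟩ := hb
  simp

theorem map_inl_union_map_inr [Fintype W] [DecidableEq W] (Q : SimpleGraph W) :
    Disjoint
      (Finset.univ.map (SimpleGraph.Embedding.sumInl (G := graphK1) (H := Q)).toEmbedding)
      (Finset.univ.map (SimpleGraph.Embedding.sumInr (G := graphK1) (H := Q)).toEmbedding) ∧
    Finset.univ.map (SimpleGraph.Embedding.sumInl (G := graphK1) (H := Q)).toEmbedding ∪
      Finset.univ.map (SimpleGraph.Embedding.sumInr (G := graphK1) (H := Q)).toEmbedding =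
      Finset.univ := by
  constructor
  · rw [Finset.disjoint_left]
    rintro (x | x) <;> simp
  · ext (x | x)
    · simpa using Subsingleton.elim x 0
    · simp

theorem shortfall_graphK1_sum [Fintype W] (Q : SimpleGraph W) (μ : ℚ) :
    shortfall (graphK1.sum Q) μ Finset.univ = shortfall Q μ Finset.univ + (μ - 1) := by
  classical
  obtain ⟨hd, hu⟩ := map_inl_union_map_inr Q
  rw [← hu, (noEdgesBetween_sum Q).shortfall_union hd, shortfall_map, shortfall_map,
    shortfall_eq (G := graphK1), properShortfall_eq_zero_of_card_le_one (by simp)]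
  simp
  ring

theorem not_connected_graphK1_sum [Nonempty W] (Q : SimpleGraph W) :
    ¬ (graphK1.sum Q).Connected := by
  intro h
  obtain ⟨w⟩ := ‹Nonempty W›
  obtain ⟨p⟩ := h.preconnected (Sum.inl 0) (Sum.inr w)
  have key : ∀ x y, (graphK1.sum Q).Walk x y → x.isLeft → y.isLeft := by
    intro x y p
    induction p with
    | nil => exact id
    | @cons a b c hab _ ih =>
      intro ha
      refine ih ?_
      rcases a with a | a <;> rcases b with b | b <;> simp_all
  simpa using key _ _ p rfl

theorem PathFourFree.graphK1_sum {Q : SimpleGraph W} (hQ : PathFourFree Q) :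
    PathFourFree (graphK1.sum Q) := by
  rintro (a | a) (b | b) (c | c) (d | d) <;> simp
  · exact fun h => absurd (Subsingleton.elim a b) h
  · exact hQ a b c d

theorem globalMean_le_graphK1_sum {n : ℕ} (hn : 2 ≤ n) [Fintype W] {Q : SimpleGraph W}
    (hW : Fintype.card W = n - 1) (hQ : IsMaxMeanConnectedCograph Q) {V : Type u} [Fintype V]
    {G : SimpleGraph V} (hV : Fintype.card V = n) (hG : IsCograph G) (hc : ¬ G.Connected) :
    globalMean G ≤ globalMean (graphK1.sum Q) := by
  classical
  have hP := hG.pathFourFree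
  have : Nonempty W := hQ.2.1.nonempty
  have : Nonempty V := Fintype.card_pos_iff.1 (by omega)
  obtain ⟨m, rfl⟩ : ∃ m, n = m + 1 := ⟨n - 1, by omega⟩
  rw [Nat.add_sub_cancel] at hW
  obtain ⟨e⟩ := hQ.nonempty_iso (by omega) hW
  set μ := globalMean (graphK1.sum Q) with hμd
  have h0 : shortfall (graphK1.sum Q) μ Finset.univ = 0 := shortfall_globalMean
  rw [shortfall_graphK1_sum, shortfall_univ_iso e] at h0
  obtain ⟨hμ, hopt⟩ := shortfall_optimalGraph_le.{u} (m := m) (by omega) (δ := 1)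
    (Or.inr rfl) (by linarith)
  -- Order at most m - 1 gives (|S| + 1)/2 ≤ m/2 ≤ μ.
  have hsmall : ∀ S : Finset V, S.Nonempty → S.card + 1 ≤ m → 0 ≤ shortfall G μ S := by
    intro S hS hSm
    have : (S.card : ℚ) + 1 ≤ m := by exact_mod_cast hSm
    exact hP.shortfall_nonneg _ S rfl hS.card_pos (by linarith)
  have hone : ∀ A B : Finset V, A.Nonempty → B.Nonempty → Disjoint A B →
      A ∪ B = Finset.univ → NoEdgesBetween G A B → A.card = 1 →
      0 ≤ shortfall G μ Finset.univ := by
    intro A B hA hB hd hu h hA1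
    have hcard := Finset.card_union_of_disjoint hd
    rw [hu, Finset.card_univ, hV] at hcard
    rw [← hu, h.shortfall_union hd]
    by_cases hBc : Conn G B
    · have := (hopt hP B (by omega) hBc).1
      rw [shortfall_eq (S := A), properShortfall_eq_zero_of_card_le_one hA1.le, hA1]
      push_cast
      linarith
    -- If the rest is disconnected, there are three mutually nonadjacent parts, all of order at most
    -- m - 1.
    · have hB2 : 2 ≤ B.card := by
        by_contra hlt
        have := hB.card_pos
        obtain ⟨x, rfl⟩ := Finset.card_eq_one.1 (show B.card = 1 by omega)
        exact hBc (conn_singleton x)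
      obtain ⟨C, D, hC, hD, hd', rfl, h' | h'⟩ := hP.splits B hB2
      · have hcard' := Finset.card_union_of_disjoint hd'
        have := hC.card_pos
        have := hD.card_pos
        rw [h'.shortfall_union hd']
        have := hsmall A hA (by omega)
        have := hsmall C hC (by omega)
        have := hsmall D hD (by omega)
        linarith
      · exact absurd (h'.conn_union hd' hC hD) hBc
  rw [globalMean_le_iff]
  obtain ⟨A, B, hA, hB, hd, hu, h | h⟩ := hP.splits Finset.univ (by rw [Finset.card_univ]; omega)
  · have hcard := Finset.card_union_of_disjoint hd
    rw [hu, Finset.card_univ, hV] at hcard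
    have hA1 := hA.card_pos
    have hB1 := hB.card_pos
    by_cases hA2 : A.card = 1
    · exact hone A B hA hB hd hu h hA2
    by_cases hB2 : B.card = 1
    · exact hone B A hB hA hd.symm (by rwa [Finset.union_comm]) h.symm hB2
    rw [← hu, h.shortfall_union hd]
    have := hsmall A hA (by omega)
    have := hsmall B hB (by omega)
    linarith
  · exact absurd (conn_univ.1 (hu ▸ h.conn_union hd hA hB)) hc

theorem isMaxMeanConnectedCograph_star {m : ℕ} (hm : 7 ≤ m) :
    IsMaxMeanConnectedCograph (completeBipartiteGraph (Fin 1) (Fin (m - 1))) := by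
  classical
  have hbip : IsCompleteBipartiteOn (completeBipartiteGraph (Fin 1) (Fin (m - 1)))
      Finset.univ 1 (m - 1) := by
    refine ⟨Finset.univ.map Function.Embedding.inl, Finset.univ.map Function.Embedding.inr,
      by simp, by simp, ?_, ?_, ?_, ?_, ?_⟩
    · rw [Finset.disjoint_left]
      rintro (x | x) <;> simp
    · ext (x | x)
      · simpa using Subsingleton.elim x 0
      · simp
    all_goals
      rintro (x | x) hx (y | y) hy <;> simp at *
  obtain ⟨e⟩ := hbip.nonempty_iso (m := m) (by simp; omega)
  refine isMaxMeanConnectedCograph_of_iso (m := m) (by omega) ?_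
  rw [optimalGraph, if_neg (by omega), show optimalSide m = 1 from if_neg (by omega)]
  exact e

end Disconnected

theorem mainTheorem7 :
    -- for each `m ≥ 1` the graph `Q_m` exists and is unique up to isomorphism
    (∀ m : ℕ, 1 ≤ m → ∃ Q : SimpleGraph (Fin m), IsMaxMeanConnectedCograph Q ∧
      ∀ Q' : SimpleGraph (Fin m), IsMaxMeanConnectedCograph Q' → Nonempty (Q' ≃g Q)) ∧
    -- `K_1 ∪ Q_{n-1}` is a disconnected cograph, and it attains the maximum
    (∀ n : ℕ, 2 ≤ n →
      ∀ (W : Type v) [Fintype W] (Q : SimpleGraph W), Fintype.card W = n - 1 →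
        IsMaxMeanConnectedCograph Q →
        (IsCograph (graphK1.sum Q) ∧ ¬ (graphK1.sum Q).Connected) ∧
        ∀ (V : Type u) [Fintype V] (G : SimpleGraph V), Fintype.card V = n →
          IsCograph G → ¬ G.Connected →
          globalMean G ≤ globalMean (graphK1.sum Q)) ∧
    -- for `n ≥ 8`, `K_1 ∪ K_{1,n-2}` is a disconnected cograph, and it attains the maximum
    (∀ n : ℕ, 8 ≤ n →
      (IsCograph (graphK1.sum (completeBipartiteGraph (Fin 1) (Fin (n - 2)))) ∧
        ¬ (graphK1.sum (completeBipartiteGraph (Fin 1) (Fin (n - 2)))).Connected) ∧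
      ∀ (V : Type u) [Fintype V] (G : SimpleGraph V), Fintype.card V = n →
        IsCograph G → ¬ G.Connected →
        globalMean G ≤
          globalMean (graphK1.sum (completeBipartiteGraph (Fin 1) (Fin (n - 2))))) := by
  refine ⟨fun m hm => ⟨optimalGraph m, isMaxMeanConnectedCograph_of_iso hm SimpleGraph.Iso.refl,
    fun Q' hQ' => hQ'.nonempty_iso hm (Fintype.card_fin m)⟩, ?_, ?_⟩
  · intro n hn W _ Q hW hQ
    have : Nonempty W := hQ.2.1.nonempty
    exact ⟨⟨hQ.1.pathFourFree.graphK1_sum.isCograph, not_connected_graphK1_sum Q⟩,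
      fun V _ G hV hG hc => globalMean_le_graphK1_sum hn hW hQ hV hG hc⟩
  · intro n hn
    have hQ := isMaxMeanConnectedCograph_star (m := n - 1) (by omega)
    rw [show n - 1 - 1 = n - 2 by omega] at hQ
    have := hQ.2.1.nonempty
    exact ⟨⟨hQ.1.pathFourFree.graphK1_sum.isCograph, not_connected_graphK1_sum _⟩,
      fun V _ G hV hG hc =>
        globalMean_le_graphK1_sum (by omega) (by simp; omega) hQ hV hG hc⟩
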